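/- **Setting.** Let $U\subset\mathbb R^m$ and $\mathcal S\subset\mathbb R^n$ be convex, compact and nonempty, $t_0<t_f$, and let $A(t)\in\mathbb R^{n\times n}$, $B(t)\in\mathbb R^{n\times m}$ be integrable on every compact subinterval of $[t_0,\infty)$. For measurable $u:[t_0,\infty)\to U$ let $y(\cdot,y_0,u)$ be the solution of $\dot y=A(t)y+B(t)u(t)$ a.e., $y(t_0)=y_0$. Put $$\mathcal R(t)=\{y_0:\ y(t,y_0,u)\in\mathcal S\text{ for some }u\},\qquad T(y_0)=\inf_u\,\min\{t\ge t_0:\ y(t,y_0,u)\in\mathcal S\}\in[t_0,\infty],$$ and assume that $\mathcal R(s)\subset\operatorname{int}\mathcal R(t)$ whenever $t_0\le s<t\le t_f$. **Discretization.** Let $K,N\ge1$, $\Delta t=(t_f-t_0)/K$, $h=\Delta t/N$, $t_i=t_0+i\Delta t$, $t_{ij}=t_i+jh$, $\bar B(t)=-B(t_0+t_f-t)$. Let $c_0,\dots,c_N\ge 0$ be quadrature weights, let the matrices $\Phi_h(t,s)\in\mathbb R^{n\times n}$ be given (approximations of the fundamental matrix of $\dot y=-A(t_0+t_f-t)y$),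 and let $l^1,\dots,l^{N_{\mathcal R}}\in\mathbb R^n$, $\eta^1,\dots,\eta^{N_U}\in\mathbb R^m$ be unit vectors. A supporting point of a set $M$ in direction $l$ is any maximizer of $\langle l,\cdot\rangle$ on $M$. Let $\widetilde U_\Delta$ consist of one supporting point of $U$ in each direction $\eta^r$, let $Y_{h\Delta}(t_0)$ consist of one supporting point of $\mathcal S$ in each direction $l^k$, and for $i=0,\dots,K-1$ let $Y_{h\Delta}(t_{i+1})$ consist of one supporting point, in each direction $l^k$, of $$\operatorname{co}\Big(\Phi_h(t_{i+1},t_i)Y_{h\Delta}(t_i)+h\sum_{j=0}^N c_j\Phi_h(t_{i+1},t_{ij})\bar B(t_{ij})\widetilde U_\Delta\Big).$$ Put $\mathcal R_{h\Delta}(t_i)=\operatorname{co}Y_{h\Delta}(t_i)$ and $\Omega=\bigcup_{i=0}^K\mathcal R_{h\Delta}(t_i)$. Given a finite simplicial triangulation $\Gamma$, into $n$-simplices, of $\Omega\setminus\operatorname{int}\mathcal R_{h\Delta}(t_0)$ whose set of vertices is $\bigcup_{i=0}^K Y_{h\Delta}(t_i)$ and each of whose simplices lies in $\mathcal R_{h\Delta}(t_{i+1})\setminus\operatorname{int}\mathcal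 R_{h\Delta}(t_i)$ for some $i\in\{0,\dots,K-1\}$, let $T_{h\Delta}:\Omega\to\mathbb R$ be $t_0$ on $\mathcal R_{h\Delta}(t_0)$, $t_i$ on $\partial\mathcal R_{h\Delta}(t_i)$ for $i=1,\dots,K$, and at all other points of $\Omega$ the piecewise linear interpolation over $\Gamma$ of these values at the vertices. **Statement.** Let $C\ge0$, $p\in\mathbb R$, $\varepsilon>0$ be such that the Hausdorff distance satisfies $d_H(\mathcal R_{h\Delta}(t_i),\mathcal R(t_i))\le Ch^p$ for $i=0,\dots,K$, that $$\mathcal R(t_i)+\varepsilon B_1(0)\subset\operatorname{int}\mathcal R(t_{i+1})\qquad(i=0,\dots,K-1),\tag{1}$$ where $B_1(0)$ is the closed unit ball, and that $Ch^p<\varepsilon/3$. Then $$\mathcal R_{h\Delta}(t_i)+\tfrac{\varepsilon}{3}B_1(0)\subset\operatorname{int}\mathcal R_{h\Delta}(t_{i+1})\qquad(i=0,\dots,K-1).$$ Moreover, for every triangulation $\Gamma$ as above, $|T(x)-T_{h\Delta}(x)|\le2\Delta t$ (with $T(x)<\infty$) for every $x\in\Omega$ which lies in $\mathcal R_{h\Delta}(t_i)$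 for some $i<K$ or satisfies $T(x)\le t_f+\Delta t$. If (1) holds also for $i=K$, with $t_{K+1}=t_f+\Delta t$, then $T$ is finite on all of $\Omega$ and $$\|T-T_{h\Delta}\|_{\infty,\Omega}=\sup_{x\in\Omega}|T(x)-T_{h\Delta}(x)|\le2\Delta t .$$ No modulus of continuity of $T$ is assumed. -/

import Mathlib

open scoped Pointwise

noncomputable section

/-- Euclidean space `ℝⁿ`. -/
abbrev Euc (n : ℕ) : Type := EuclideanSpace ℝ (Fin n)

/-- The data of the linear control problem `y' = A(t) y + B(t) u`, `u(t) ∈ U`, on `[t₀, ∞)`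
with target set `S`. -/
structure LinearControlSystem (n m : ℕ) where
  t₀ : ℝ
  A : ℝ → Matrix (Fin n) (Fin n) ℝ
  B : ℝ → Matrix (Fin n) (Fin m) ℝ
  U : Set (Euc m)
  S : Set (Euc n)

namespace LinearControlSystem

variable {n m : ℕ} (P : LinearControlSystem n m)

/-- Admissible controls: measurable functions with values in `U` on `[t₀, ∞)`
(the values before `t₀` are irrelevant). -/
def IsAdmissible (u : ℝ → Euc m) : Prop :=
  Measurable u ∧ ∀ t, P.t₀ ≤ t → u t ∈ P.U

/-- `y` is the (Carathéodory) solution on `[t₀, ∞)` of `y' = A y + B u` a.e., `y(t₀) = y₀`,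
in integrated form. -/
def IsSolution (y₀ : Euc n) (u : ℝ → Euc m) (y : ℝ → Euc n) : Prop :=
  ContinuousOn y (Set.Ici P.t₀) ∧
    ∀ t, P.t₀ ≤ t →
      y t = y₀ + ∫ s in P.t₀..t,
        (Matrix.toEuclideanLin (P.A s) (y s) + Matrix.toEuclideanLin (P.B s) (u s))

/-- The reachable set for fixed end time `t`: the starting points (at time `t₀`) from which some
admissible control steers the system into the target at time `t`. -/
def reach (t : ℝ) : Set (Euc n) :=
  {y₀ | P.t₀ ≤ t ∧ ∃ u y, P.IsAdmissible u ∧ P.IsSolution y₀ u y ∧ y t ∈ P.S}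

/-- First time `t ≥ t₀` at which the trajectory `y` is in the target (`⊤` if there is none). -/
def hitTime (y : ℝ → Euc n) : EReal :=
  ⨅ (t : ℝ) (_ : P.t₀ ≤ t ∧ y t ∈ P.S), (t : EReal)

/-- The minimum time function, with values in `[t₀, ∞]`. -/
def minTime (y₀ : Euc n) : EReal :=
  ⨅ (u : ℝ → Euc m) (y : ℝ → Euc n) (_ : P.IsAdmissible u ∧ P.IsSolution y₀ u y), P.hitTime y

/-- The standing assumptions (i)-(iv) on the control problem up to the final time `tf`. -/
structure StandingAssumptions (tf : ℝ) : Prop where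
  t₀_lt : P.t₀ < tf
  integrable_A : ∀ i j b, MeasureTheory.IntegrableOn (fun t => P.A t i j) (Set.Icc P.t₀ b)
  integrable_B : ∀ i j b, MeasureTheory.IntegrableOn (fun t => P.B t i j) (Set.Icc P.t₀ b)
  U_convex : Convex ℝ P.U
  U_compact : IsCompact P.U
  U_nonempty : P.U.Nonempty
  S_convex : Convex ℝ P.S
  S_compact : IsCompact P.S
  S_nonempty : P.S.Nonempty
  strictly_expanding : ∀ t₁ t₂, P.t₀ ≤ t₁ → t₁ < t₂ → t₂ ≤ tf →
    P.reach t₁ ⊆ interior (P.reach t₂)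

end LinearControlSystem

/-- The supporting face of `A` in the direction `l`: the maximizers of `⟨l, ·⟩` on `A`. -/
def supportFace {n : ℕ} (l : Euc n) (A : Set (Euc n)) : Set (Euc n) :=
  {x | x ∈ A ∧ ∀ z ∈ A, inner ℝ l z ≤ inner ℝ l x}

/-- The parameters of the full discretization: the final time, `K` macro steps, each divided into
`N` steps of the numerical scheme; approximations `Φh t s` of the fundamental matrix of the
time-reversed system; quadrature weights `c 0, …, c N`; finitely many unit directions `l k` in the
state space and `η r` in the control space. -/
structure Discretization (n m : ℕ) where
  tf : ℝ
  K : ℕ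
  N : ℕ
  K_pos : 0 < K
  N_pos : 0 < N
  Φh : ℝ → ℝ → Matrix (Fin n) (Fin n) ℝ
  c : ℕ → ℝ
  c_nonneg : ∀ j, 0 ≤ c j
  numR : ℕ
  numU : ℕ
  l : Fin numR → Euc n
  η : Fin numU → Euc m
  l_unit : ∀ k, ‖l k‖ = 1
  η_unit : ∀ r, ‖η r‖ = 1

namespace Discretization

variable {n m : ℕ} (D : Discretization n m) (P : LinearControlSystem n m)

/-- `Δt = (tf - t₀) / K`. -/
def dt : ℝ := (D.tf - P.t₀) / D.K

/-- `h = Δt / N`. -/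
def h : ℝ := D.dt P / D.N

/-- `t_i = t₀ + i Δt`. -/
def time (i : ℕ) : ℝ := P.t₀ + i * D.dt P

/-- `t_{ij} = t_i + j h`. -/
def subtime (i j : ℕ) : ℝ := D.time P i + j * D.h P

/-- The control matrix `t ↦ -B(t₀ + tf - t)` of the time-reversed system. -/
def Bbar (t : ℝ) : Matrix (Fin n) (Fin m) ℝ := -P.B (P.t₀ + D.tf - t)

/-- One macro step applied to a set `Y` of points, with discretized control set `V`:
`Φ_h(t_{i+1}, t_i) Y + h ∑_{j=0}^N c_j Φ_h(t_{i+1}, t_{ij}) B̄(t_{ij}) V` (Minkowski sums). -/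
def macroStep (V : Set (Euc m)) (i : ℕ) (Y : Set (Euc n)) : Set (Euc n) :=
  Matrix.toEuclideanLin (D.Φh (D.time P (i + 1)) (D.time P i)) '' Y +
    D.h P • ∑ j ∈ Finset.range (D.N + 1), D.c j •
      (Matrix.toEuclideanLin
        (D.Φh (D.time P (i + 1)) (D.subtime P i j) * D.Bbar P (D.subtime P i j)) '' V)

/-- `v` and `y` record the choices of supporting points made in a run of the algorithm: `v r` is
a supporting point of `U` in direction `η r`; `y 0 k` is a supporting point of `S` in direction
`l k`; and `y (i+1) k` is a supporting point in direction `l k` of the convex hull of the points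
obtained from `{y i k'}` and `{v r}` by one macro step. -/
structure IsRun (v : Fin D.numU → Euc m) (y : ℕ → Fin D.numR → Euc n) : Prop where
  control : ∀ r, v r ∈ supportFace (D.η r) P.U
  start : ∀ k, y 0 k ∈ supportFace (D.l k) P.S
  step : ∀ i, i < D.K → ∀ k, y (i + 1) k ∈
    supportFace (D.l k) (convexHull ℝ (D.macroStep P (Set.range v) i (Set.range (y i))))

/-- The fully discrete reachable set `R_{hΔ}(t_i)`, the convex hull of the computed supporting
points. -/
def discReach (y : ℕ → Fin D.numR → Euc n) (i : ℕ) : Set (Euc n) :=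
  convexHull ℝ (Set.range (y i))

/-- The computational domain `Ω = ⋃_{i=0,…,K} R_{hΔ}(t_i)`. -/
def domain (y : ℕ → Fin D.numR → Euc n) : Set (Euc n) :=
  ⋃ i ∈ Set.Iic D.K, D.discReach y i

/-- `Γ` is a simplicial triangulation of `Ω \ int R_{hΔ}(t₀)` into finitely many `n`-simplices
(and their faces) whose vertices are the computed supporting points, and each of whose simplices
lies in one of the layers `R_{hΔ}(t_{i+1}) \ int R_{hΔ}(t_i)`. -/
structure IsTriangulation (y : ℕ → Fin D.numR → Euc n)
    (Γ : Geometry.SimplicialComplex ℝ (Euc n)) : Prop where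
  finite : Γ.faces.Finite
  pure : ∀ s ∈ Γ.faces, ∃ s' ∈ Γ.faces, s ⊆ s' ∧ s'.card = n + 1
  space_eq : Γ.space = D.domain y \ interior (D.discReach y 0)
  vertices_eq : Γ.vertices = ⋃ i ∈ Set.Iic D.K, Set.range (y i)
  layer : ∀ s ∈ Γ.faces, ∃ i, i < D.K ∧
    convexHull ℝ (s : Set (Euc n)) ⊆ D.discReach y (i + 1) \ interior (D.discReach y i)

open Classical in
/-- The values prescribed on `R_{hΔ}(t₀)` (namely `t₀`) and on the boundaries
`∂R_{hΔ}(t_i)`, `i = 1, …, K` (namely `t_i`). -/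
def levelTime (y : ℕ → Fin D.numR → Euc n) (x : Euc n) : ℝ :=
  if x ∈ D.discReach y 0 then P.t₀
  else D.time P (sInf {i : ℕ | 1 ≤ i ∧ i ≤ D.K ∧ x ∈ frontier (D.discReach y i)})

end Discretization

open Classical in
/-- The piecewise linear interpolation over `Γ` of nodal values `f`: if `x = ∑ λ_v v` is a convex
combination of the vertices of a simplex of `Γ`, the value at `x` is `∑ λ_v f(v)`. In a simplicial
complex this depends neither on the simplex nor on the weights; outside of `Γ` it is `0`. -/
def simplicialInterp {n : ℕ} (Γ : Geometry.SimplicialComplex ℝ (Euc n)) (f : Euc n → ℝ)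
    (x : Euc n) : ℝ :=
  if hx : ∃ p : Finset (Euc n) × (Euc n → ℝ), p.1 ∈ Γ.faces ∧ (∀ v ∈ p.1, 0 ≤ p.2 v) ∧
      ∑ v ∈ p.1, p.2 v = 1 ∧ ∑ v ∈ p.1, p.2 v • v = x
  then ∑ v ∈ hx.choose.1, hx.choose.2 v * f v
  else 0

open Classical in
/-- The fully discrete minimum time function `T_{hΔ}`: the prescribed values on `R_{hΔ}(t₀)` and on
the boundaries of the `R_{hΔ}(t_i)`, and piecewise linear interpolation elsewhere in `Ω`. -/
def Discretization.discMinTime {n m : ℕ} (D : Discretization n m) (P : LinearControlSystem n m)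
    (y : ℕ → Fin D.numR → Euc n) (Γ : Geometry.SimplicialComplex ℝ (Euc n)) (x : Euc n) : ℝ :=
  if x ∈ D.discReach y 0 ∨ ∃ i, 1 ≤ i ∧ i ≤ D.K ∧ x ∈ frontier (D.discReach y i)
  then D.levelTime P y x
  else simplicialInterp Γ (D.levelTime P y) x

end

/-! Write R_i for the reachable set at t_i and D_i for its discrete version. Everything reduces to
inclusions. A convex compact set whose Hausdorff distance to R is less than r contains in its
interior the center of any ball of radius greater than r lying in R
(`Convex.mem_interior_of_hausdorffEDist_lt`); R itself need not be convex. Points of D_i are within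
ε/3 of R_i, so (1) leaves room for a shift by ε/3 and a further ball of radius ε/3 inside R_{i+1};
this gives the gap between D_i and D_{i+1}. Likewise D_i ⊆ R_{i+1} and R_i ⊆ int D_{i+1}.

Hence, strictly between D_i and D_{i+1}, T lies in [t_{i-1}, t_{i+2}], while interpolation gives a
value in [t_i, t_{i+1}]; the difference is at most 2Δt. Only the upper bound on D_K needs
information beyond t_f. -/

/-! ### Convex sets and Hausdorff distance -/

section Convex

variable {E : Type*} [NormedAddCommGroup E] [InnerProductSpace ℝ E]

/-- Cancellation of a ball: if every point of the ball of radius `r + σ` about `x` is within `r` of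
the complete convex set `D`, then the ball of radius `σ` is contained in `D`. -/
theorem Convex.closedBall_subset_of_forall_dist_le {D : Set E} (hD : Convex ℝ D)
    (hDc : IsComplete D) {x : E} {r σ : ℝ} (hr : 0 ≤ r)
    (h : ∀ z ∈ Metric.closedBall x (r + σ), ∃ d ∈ D, dist z d ≤ r) :
    Metric.closedBall x σ ⊆ D := by
  intro z hz
  rw [Metric.mem_closedBall] at hz
  have hne : D.Nonempty := by
    obtain ⟨d, hd, -⟩ := h z (by rw [Metric.mem_closedBall]; linarith)
    exact ⟨d, hd⟩
  obtain ⟨p, hpD, hp⟩ := exists_norm_eq_iInf_of_complete_convex hne hDc hD z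
  rw [norm_eq_iInf_iff_real_inner_le_zero hD hpD] at hp
  by_contra hzD
  have hzp : 0 < ‖z - p‖ := norm_pos_iff.2 (sub_ne_zero.2 fun e => hzD (e ▸ hpD))
  -- Push `z` a further distance `r` away from its projection `p`: the new point is still in the
  -- large ball, but its distance to `D` is `r + ‖z - p‖ > r`.
  obtain ⟨d, hd, hqd⟩ := h (z + (r / ‖z - p‖) • (z - p)) (by
    rw [Metric.mem_closedBall, dist_eq_norm]
    calc ‖z + (r / ‖z - p‖) • (z - p) - x‖
        = ‖(r / ‖z - p‖) • (z - p) + (z - x)‖ := by congr 1; abel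
      _ ≤ ‖(r / ‖z - p‖) • (z - p)‖ + ‖z - x‖ := norm_add_le _ _
      _ ≤ r + σ := by
        rw [norm_smul, Real.norm_of_nonneg (by positivity), div_mul_cancel₀ _ hzp.ne',
          ← dist_eq_norm z x]
        gcongr)
  have h₁ := hp d hd
  have h₂ := real_inner_le_norm (z - p) (z + (r / ‖z - p‖) • (z - p) - d)
  rw [← dist_eq_norm (z + _)] at h₂
  have h₃ : inner ℝ (z - p) (z + (r / ‖z - p‖) • (z - p) - d)
      = ‖z - p‖ * ‖z - p‖ + r * ‖z - p‖ - inner ℝ (z - p) (d - p) := by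
    have : z + (r / ‖z - p‖) • (z - p) - d
        = (z - p) + (r / ‖z - p‖) • (z - p) - (d - p) := by abel
    rw [this, inner_sub_right, inner_add_right, inner_smul_right, real_inner_self_eq_norm_mul_norm]
    field_simp
  nlinarith [mul_le_mul_of_nonneg_left hqd hzp.le, mul_pos hzp hzp]

theorem Convex.mem_interior_of_hausdorffEDist_lt {D R : Set E} (hD : Convex ℝ D)
    (hDc : IsComplete D) {x : E} {r s : ℝ} (hr : 0 ≤ r) (hrs : r < s)
    (hDR : Metric.hausdorffEDist D R < ENNReal.ofReal r) (hx : Metric.closedBall x s ⊆ R) :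
    x ∈ interior D := by
  have hsub : Metric.closedBall x (s - r) ⊆ D := by
    refine hD.closedBall_subset_of_forall_dist_le hDc hr fun z hz => ?_
    rw [add_sub_cancel] at hz
    rw [Metric.hausdorffEDist_comm] at hDR
    obtain ⟨d, hd, hzd⟩ := Metric.exists_edist_lt_of_hausdorffEDist_lt (hx hz) hDR
    exact ⟨d, hd, (edist_lt_ofReal.1 hzd).le⟩
  exact mem_interior_iff_mem_nhds.2
    (Filter.mem_of_superset (Metric.closedBall_mem_nhds x (sub_pos.2 hrs)) hsub)

end Convex

/-- A supporting point of a set in a nonzero direction lies on its frontier. -/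
theorem mem_frontier_of_forall_inner_le {n : ℕ} {l x : Euc n} {A : Set (Euc n)} (hl : l ≠ 0)
    (hx : x ∈ A) (hmax : ∀ z ∈ A, inner ℝ l z ≤ inner ℝ l x) : x ∈ frontier A := by
  refine ⟨subset_closure hx, fun hint => ?_⟩
  have hcont : Filter.Tendsto (fun s : ℝ => x + s • l) (nhdsWithin 0 (Set.Ioi 0)) (nhds x) := by
    have : Continuous fun s : ℝ => x + s • l := by fun_prop
    simpa using (this.tendsto 0).mono_left nhdsWithin_le_nhds
  obtain ⟨s, hsA, hs⟩ := ((hcont.eventually (mem_interior_iff_mem_nhds.1 hint)).and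
    self_mem_nhdsWithin).exists
  have h := hmax _ hsA
  rw [inner_add_right, inner_smul_right] at h
  have := mul_pos (Set.mem_Ioi.1 hs) (real_inner_self_pos.2 hl)
  linarith

/-! ### Minimum time and reachable sets -/

namespace LinearControlSystem

variable {n m : ℕ} {P : LinearControlSystem n m} {x : Euc n} {t tf : ℝ}

theorem minTime_le_of_mem_reach (hx : x ∈ P.reach t) : P.minTime x ≤ t := by
  obtain ⟨ht, u, y, hu, hy, hyS⟩ := hx
  have hhit : P.hitTime y ≤ t := iInf₂_le t ⟨ht, hyS⟩
  exact iInf_le_of_le u (iInf_le_of_le y (iInf_le_of_le ⟨hu, hy⟩ hhit))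

theorem le_minTime_of_forall_mem_reach {c : EReal} (h : ∀ s, x ∈ P.reach s → c ≤ s) :
    c ≤ P.minTime x :=
  le_iInf fun u => le_iInf fun y => le_iInf fun huy => le_iInf fun s => le_iInf fun hs =>
    h s ⟨hs.1, u, y, huy.1, huy.2, hs.2⟩

theorem t₀_le_minTime : (P.t₀ : EReal) ≤ P.minTime x :=
  le_minTime_of_forall_mem_reach fun _ hs => EReal.coe_le_coe_iff.2 hs.1

/-- Hitting the target at some `s < t` would put `x` in the reachable set at `s`, hence by strict
expansion in the one at `t`. -/
theorem StandingAssumptions.le_minTime_of_notMem_reach (hP : P.StandingAssumptions tf)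
    (ht : t ≤ tf) (hx : x ∉ P.reach t) : (t : EReal) ≤ P.minTime x := by
  refine le_minTime_of_forall_mem_reach fun s hs => EReal.coe_le_coe_iff.2 ?_
  by_contra! hst
  exact hx (interior_subset (hP.strictly_expanding s t hs.1 hst ht hs))

end LinearControlSystem

theorem EReal.ne_top_and_abs_toReal_sub_le {T : EReal} {a b c d : ℝ} (ha : (a : EReal) ≤ T)
    (hb : T ≤ b) (hac : c - d ≤ a) (hbc : b ≤ c + d) : T ≠ ⊤ ∧ |T.toReal - c| ≤ d := by
  have hT : T ≠ ⊤ := ne_top_of_le_ne_top (EReal.coe_ne_top b) hb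
  have hT' : T ≠ ⊥ := ne_bot_of_le_ne_bot (EReal.coe_ne_bot a) ha
  lift T to ℝ using ⟨hT, hT'⟩
  rw [EReal.coe_le_coe_iff] at ha hb
  refine ⟨hT, ?_⟩
  rw [EReal.toReal_coe, abs_le]
  constructor <;> linarith

/-- The simplex and weights are an arbitrary choice, so the bound is asked on every simplex
containing `x`; independence of the choice is then not needed. -/
theorem simplicialInterp_mem_Icc {n : ℕ} {Γ : Geometry.SimplicialComplex ℝ (Euc n)}
    {f : Euc n → ℝ} {x : Euc n} {a b : ℝ} (hx : x ∈ Γ.space)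
    (hf : ∀ s ∈ Γ.faces, x ∈ convexHull ℝ (s : Set (Euc n)) → ∀ w ∈ s, f w ∈ Set.Icc a b) :
    simplicialInterp Γ f x ∈ Set.Icc a b := by
  have hex : ∃ p : Finset (Euc n) × (Euc n → ℝ), p.1 ∈ Γ.faces ∧ (∀ v ∈ p.1, 0 ≤ p.2 v) ∧
      ∑ v ∈ p.1, p.2 v = 1 ∧ ∑ v ∈ p.1, p.2 v • v = x := by
    obtain ⟨s, hs, hxs⟩ := Geometry.SimplicialComplex.mem_space_iff.1 hx
    obtain ⟨w, hw₀, hw₁, hwx⟩ := Finset.mem_convexHull'.1 hxs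
    exact ⟨(s, w), hs, hw₀, hw₁, hwx⟩
  rw [simplicialInterp, dif_pos hex]
  obtain ⟨hs, hw₀, hw₁, hwx⟩ := hex.choose_spec
  have hxs : x ∈ convexHull ℝ (hex.choose.1 : Set (Euc n)) :=
    Finset.mem_convexHull'.2 ⟨_, hw₀, hw₁, hwx⟩
  have := (convex_Icc a b).sum_mem hw₀ hw₁ (hf _ hs hxs)
  simpa only [smul_eq_mul] using this

/-! ### Nested discrete reachable sets and interpolated values -/

namespace Discretization

variable {n m : ℕ} {D : Discretization n m} {P : LinearControlSystem n m}
  {v : Fin D.numU → Euc m} {y : ℕ → Fin D.numR → Euc n}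

theorem dt_pos (h : P.t₀ < D.tf) : 0 < D.dt P :=
  div_pos (sub_pos.2 h) (Nat.cast_pos.2 D.K_pos)

theorem time_zero : D.time P 0 = P.t₀ := by simp [time]

theorem time_succ (i : ℕ) : D.time P (i + 1) = D.time P i + D.dt P := by
  simp only [time, Nat.cast_succ]; ring

theorem time_K : D.time P D.K = D.tf := by
  have : (D.K : ℝ) ≠ 0 := Nat.cast_ne_zero.2 D.K_pos.ne'
  simp only [time, dt]; field_simp; ring

theorem time_mono (h : P.t₀ < D.tf) : Monotone (D.time P) :=
  monotone_nat_of_le_succ fun i => by rw [time_succ]; linarith [dt_pos h]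

theorem isCompact_discReach (i : ℕ) : IsCompact (D.discReach y i) :=
  (Set.finite_range _).isCompact_convexHull ℝ

theorem convex_discReach (i : ℕ) : Convex ℝ (D.discReach y i) := convex_convexHull ℝ _

theorem mem_discReach (i : ℕ) (k : Fin D.numR) : y i k ∈ D.discReach y i :=
  subset_convexHull ℝ _ ⟨k, rfl⟩

/-- The computed supporting points lie on the boundary of the discrete reachable sets. -/
theorem IsRun.mem_frontier (hrun : D.IsRun P v y) (hS : Convex ℝ P.S) {i : ℕ} (hi : i ≤ D.K)
    (k : Fin D.numR) : y i k ∈ frontier (D.discReach y i) := by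
  have hl : D.l k ≠ 0 := norm_ne_zero_iff.1 (by rw [D.l_unit]; exact one_ne_zero)
  refine mem_frontier_of_forall_inner_le hl (mem_discReach i k) ?_
  cases i with
  | zero =>
    exact fun z hz => (hrun.start k).2 z
      (convexHull_min (by rintro _ ⟨k, rfl⟩; exact (hrun.start k).1) hS hz)
  | succ i =>
    exact fun z hz => (hrun.step i hi k).2 z
      (convexHull_min (by rintro _ ⟨k, rfl⟩; exact (hrun.step i hi k).1) (convex_convexHull ℝ _) hz)

theorem frontier_discReach_subset (i : ℕ) :
    frontier (D.discReach y i) ⊆ D.discReach y i :=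
  (isCompact_discReach i).isClosed.frontier_subset

theorem discReach_subset_interior
    (hD : ∀ i < D.K, D.discReach y i ⊆ interior (D.discReach y (i + 1)))
    {i j : ℕ} (hij : i < j) (hj : j ≤ D.K) :
    D.discReach y i ⊆ interior (D.discReach y j) := by
  induction j, hij using Nat.le_induction with
  | base => exact hD i hj
  | succ j hij ih => exact ((ih (by omega)).trans interior_subset).trans (hD j hj)

theorem frontier_discReach_le
    (hD : ∀ i < D.K, D.discReach y i ⊆ interior (D.discReach y (i + 1)))
    {i j : ℕ} {x : Euc n} (hx : x ∈ D.discReach y j)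
    (hxi : x ∈ frontier (D.discReach y i)) (hi : i ≤ D.K) : i ≤ j := by
  by_contra! h
  exact hxi.2 (discReach_subset_interior hD h hi hx)

theorem levelTime_of_mem_frontier
    (hD : ∀ i < D.K, D.discReach y i ⊆ interior (D.discReach y (i + 1)))
    {i : ℕ} {x : Euc n} (hi : i ≤ D.K)
    (hx : x ∈ frontier (D.discReach y i)) : D.levelTime P y x = D.time P i := by
  have hxi := frontier_discReach_subset i hx
  by_cases h₀ : x ∈ D.discReach y 0
  · rw [levelTime, if_pos h₀, Nat.le_zero.1 (frontier_discReach_le hD h₀ hx hi), time_zero]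
  · rw [levelTime, if_neg h₀]
    -- Strict nesting makes the boundaries disjoint, so the infimum is over a singleton.
    have : {j : ℕ | 1 ≤ j ∧ j ≤ D.K ∧ x ∈ frontier (D.discReach y j)} = {i} := by
      ext j
      refine ⟨fun ⟨_, hj, hxj⟩ => le_antisymm (frontier_discReach_le hD hxi hxj hj)
        (frontier_discReach_le hD (frontier_discReach_subset j hxj) hx hi), ?_⟩
      rintro rfl
      exact ⟨Nat.one_le_iff_ne_zero.2 fun h => h₀ (h ▸ hxi), hi, hx⟩
    rw [this, csInf_singleton]

/-- Strictly inside a layer the discrete minimum time function takes values between the times of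
its two boundaries. -/
theorem IsTriangulation.simplicialInterp_mem_Icc
    (hD : ∀ i < D.K, D.discReach y i ⊆ interior (D.discReach y (i + 1)))
    {Γ : Geometry.SimplicialComplex ℝ (Euc n)}
    (hΓ : D.IsTriangulation y Γ) (hrun : D.IsRun P v y) (hS : Convex ℝ P.S) (ht : P.t₀ < D.tf)
    {i : ℕ} (hi : i < D.K) {x : Euc n} (hxi : x ∉ D.discReach y i)
    (hxi' : x ∈ interior (D.discReach y (i + 1))) :
    simplicialInterp Γ (D.levelTime P y) x ∈ Set.Icc (D.time P i) (D.time P (i + 1)) := by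
  refine _root_.simplicialInterp_mem_Icc ?_ fun s hs hxs w hw => ?_
  · rw [hΓ.space_eq]
    refine ⟨Set.mem_biUnion (Set.mem_Iic.2 (Nat.succ_le_of_lt hi)) (interior_subset hxi'),
      fun h₀ => hxi ?_⟩
    rcases Nat.eq_zero_or_pos i with rfl | hpos
    · exact interior_subset h₀
    · exact interior_subset (discReach_subset_interior hD hpos hi.le (interior_subset h₀))
  · obtain ⟨j, hj, hsub⟩ := hΓ.layer s hs
    -- A simplex containing `x` lies in a single layer, and strict nesting rules out every layer but
    -- that of `x`.
    have hji : j = i := by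
      obtain ⟨hx₁, hx₂⟩ := hsub hxs
      refine le_antisymm ?_ ?_
      · by_contra! h
        rcases Nat.lt_or_eq_of_le (Nat.succ_le_of_lt h) with h | rfl
        · exact hx₂ (discReach_subset_interior hD h hj.le (interior_subset hxi'))
        · exact hx₂ hxi'
      · by_contra! h
        rcases Nat.lt_or_eq_of_le (Nat.succ_le_of_lt h) with h | rfl
        · exact hxi (interior_subset (discReach_subset_interior hD h hi.le hx₁))
        · exact hxi hx₁
    subst hji
    obtain ⟨hw₁, hw₂⟩ := hsub (subset_convexHull ℝ _ hw)
    have hwv : w ∈ Γ.vertices :=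
      Γ.down_closed hs (Finset.singleton_subset_iff.2 hw) (Finset.singleton_nonempty w)
    rw [hΓ.vertices_eq] at hwv
    obtain ⟨k, hk, r, rfl⟩ := Set.mem_iUnion₂.1 hwv
    -- The vertex is on the boundary of its own set `k`; lying in layer `j` forces `j ≤ k ≤ j + 1`.
    have hfr := hrun.mem_frontier hS hk r
    rw [levelTime_of_mem_frontier hD hk hfr]
    refine ⟨time_mono ht ?_, time_mono ht (frontier_discReach_le hD hw₁ hfr hk)⟩
    by_contra! h
    exact hw₂ (discReach_subset_interior hD h hj.le (mem_discReach k r))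

/-- The error bound for a point of the discrete domain whose minimum time exceeds the time of no
discrete reachable set containing it by more than one step. -/
theorem IsTriangulation.abs_minTime_sub_le
    (hD : ∀ i < D.K, D.discReach y i ⊆ interior (D.discReach y (i + 1)))
    {Γ : Geometry.SimplicialComplex ℝ (Euc n)}
    (hΓ : D.IsTriangulation y Γ) (hrun : D.IsRun P v y) (hS : Convex ℝ P.S) (ht : P.t₀ < D.tf)
    {x : Euc n} (hx : x ∈ D.domain y)
    (hupper : ∀ i ≤ D.K, x ∈ D.discReach y i → P.minTime x ≤ (D.time P (i + 1) : ℝ))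
    (hlower : ∀ i < D.K, x ∉ interior (D.discReach y (i + 1)) →
      (D.time P i : EReal) ≤ P.minTime x) :
    P.minTime x ≠ ⊤ ∧ |(P.minTime x).toReal - D.discMinTime P y Γ x| ≤ 2 * D.dt P := by
  have hdt := dt_pos ht
  have hlower' : ∀ i ≤ D.K, x ∉ interior (D.discReach y i) →
      ((D.time P i - D.dt P : ℝ) : EReal) ≤ P.minTime x := by
    intro i hi hxi
    cases i with
    | zero =>
      refine le_trans (EReal.coe_le_coe_iff.2 ?_) P.t₀_le_minTime
      rw [time_zero]; linarith
    | succ i =>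
      rw [time_succ, add_sub_cancel_right]
      exact hlower i hi hxi
  by_cases h₀ : x ∈ D.discReach y 0
  · have hval : D.discMinTime P y Γ x = P.t₀ := by
      rw [discMinTime, if_pos (Or.inl h₀), levelTime, if_pos h₀]
    rw [hval]
    refine EReal.ne_top_and_abs_toReal_sub_le P.t₀_le_minTime (hupper 0 (Nat.zero_le _) h₀) ?_ ?_
    · linarith
    · rw [time_succ, time_zero]; linarith
  by_cases hfr : ∃ i, 1 ≤ i ∧ i ≤ D.K ∧ x ∈ frontier (D.discReach y i)
  · have hval : D.discMinTime P y Γ x = D.levelTime P y x := by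
      rw [discMinTime, if_pos (Or.inr hfr)]
    obtain ⟨i, -, hi, hxi⟩ := hfr
    rw [hval, levelTime_of_mem_frontier hD hi hxi]
    refine EReal.ne_top_and_abs_toReal_sub_le (hlower' i hi hxi.2)
      (hupper i hi (frontier_discReach_subset i hxi)) ?_ ?_
    · linarith
    · rw [time_succ]; linarith
  · have hval : D.discMinTime P y Γ x = simplicialInterp Γ (D.levelTime P y) x := by
      rw [discMinTime, if_neg (not_or.2 ⟨h₀, hfr⟩)]
    -- `i + 1` is the first index whose set contains `x`.
    obtain ⟨i, hi, hxi, hxi'⟩ : ∃ i < D.K, x ∉ D.discReach y i ∧ x ∈ D.discReach y (i + 1) := by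
      classical
      obtain ⟨j, hj, hxj⟩ := Set.mem_iUnion₂.1 hx
      have hex : ∃ j, x ∈ D.discReach y j := ⟨j, hxj⟩
      obtain ⟨i, hi⟩ := Nat.exists_eq_succ_of_ne_zero
        (fun h : Nat.find hex = 0 => h₀ (h ▸ Nat.find_spec hex))
      have hle : Nat.find hex ≤ D.K := (Nat.find_min' hex hxj).trans hj
      exact ⟨i, by omega, Nat.find_min hex (by omega),
        (congrArg (fun k => x ∈ D.discReach y k) hi).mp (Nat.find_spec hex)⟩
    have hint : x ∈ interior (D.discReach y (i + 1)) := by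
      by_contra hn
      exact hfr ⟨i + 1, by omega, hi, subset_closure hxi', hn⟩
    obtain ⟨h₁, h₂⟩ := hΓ.simplicialInterp_mem_Icc hD hrun hS ht hi hxi hint
    rw [hval]
    rw [time_succ] at h₂
    -- The only case that uses the full 2Δt: one step from the layer's width, one from the error in
    -- T.
    refine EReal.ne_top_and_abs_toReal_sub_le
      (hlower' i hi.le fun h => hxi (interior_subset h)) (hupper (i + 1) hi hxi') ?_ ?_
    · linarith
    · rw [time_succ, time_succ]; linarith

end Discretization

theorem proposition3p7 {n m : ℕ} (P : LinearControlSystem n m) (D : Discretization n m)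
    (hP : P.StandingAssumptions D.tf)
    (v : Fin D.numU → Euc m) (y : ℕ → Fin D.numR → Euc n) (hrun : D.IsRun P v y)
    (C p ε : ℝ) (hC : 0 ≤ C) (hε : 0 < ε)
    (hdist : ∀ i ≤ D.K, Metric.hausdorffEDist (D.discReach y i) (P.reach (D.time P i)) ≤
      ENNReal.ofReal (C * D.h P ^ p))
    (hnest : ∀ i < D.K, P.reach (D.time P i) + Metric.closedBall 0 ε ⊆
      interior (P.reach (D.time P (i + 1))))
    (hsmall : C * D.h P ^ p < ε / 3) :
    (∀ i < D.K, D.discReach y i + Metric.closedBall 0 (ε / 3) ⊆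
      interior (D.discReach y (i + 1))) ∧
    ∀ Γ : Geometry.SimplicialComplex ℝ (Euc n), D.IsTriangulation y Γ →
      (∀ x ∈ D.domain y,
        ((∃ i < D.K, x ∈ D.discReach y i) ∨ P.minTime x ≤ (D.tf + D.dt P : ℝ)) →
          P.minTime x ≠ ⊤ ∧ |(P.minTime x).toReal - D.discMinTime P y Γ x| ≤ 2 * D.dt P) ∧
      (P.reach D.tf + Metric.closedBall 0 ε ⊆ interior (P.reach (D.tf + D.dt P)) →
        ∀ x ∈ D.domain y,
          P.minTime x ≠ ⊤ ∧ |(P.minTime x).toReal - D.discMinTime P y Γ x| ≤ 2 * D.dt P) := by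
  have ht := hP.t₀_lt
  -- A strict Hausdorff bound is needed to extract nearby points; the maximum with 0 keeps `r`
  -- positive even if the error bound vanishes.
  obtain ⟨r, hr, hrε⟩ := exists_between (max_lt hsmall (div_pos hε three_pos))
  obtain ⟨hr₁, hr₀⟩ := max_lt_iff.1 hr
  have hdist' : ∀ i ≤ D.K,
      Metric.hausdorffEDist (D.discReach y i) (P.reach (D.time P i)) < ENNReal.ofReal r :=
    fun i hi => (hdist i hi).trans_lt ((ENNReal.ofReal_lt_ofReal_iff hr₀).2 hr₁)
  have hclose : ∀ i ≤ D.K, ∀ x ∈ D.discReach y i, ∃ z ∈ P.reach (D.time P i), dist x z < ε / 3 := by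
    intro i hi x hx
    obtain ⟨z, hz, hxz⟩ := Metric.exists_edist_lt_of_hausdorffEDist_lt hx (hdist' i hi)
    exact ⟨z, hz, (edist_lt_ofReal.1 hxz).trans hrε⟩
  have hball : ∀ i < D.K, ∀ z ∈ P.reach (D.time P i), ∀ w, dist w z ≤ ε →
      w ∈ P.reach (D.time P (i + 1)) := by
    intro i hi z hz w hwz
    refine interior_subset (hnest i hi ⟨z, hz, w - z, ?_, add_sub_cancel z w⟩)
    rwa [mem_closedBall_zero_iff, ← dist_eq_norm]
  have hinterior : ∀ i < D.K, ∀ x, Metric.closedBall x (ε / 3) ⊆ P.reach (D.time P (i + 1)) →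
      x ∈ interior (D.discReach y (i + 1)) := fun i hi x hx =>
    (Discretization.convex_discReach _).mem_interior_of_hausdorffEDist_lt
      (Discretization.isCompact_discReach _).isComplete hr₀.le hrε (hdist' _ hi) hx
  have hgap : ∀ i < D.K, D.discReach y i + Metric.closedBall 0 (ε / 3) ⊆
      interior (D.discReach y (i + 1)) := by
    rintro i hi _ ⟨x, hx, b, hb, rfl⟩
    obtain ⟨z, hz, hxz⟩ := hclose i hi.le x hx
    refine hinterior i hi _ fun w hw => hball i hi z hz w ?_
    have hxb : dist (x + b) x ≤ ε / 3 := by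
      simpa [dist_eq_norm] using mem_closedBall_zero_iff.1 hb
    linarith [dist_triangle4 w (x + b) x z, Metric.mem_closedBall.1 hw]
  have hD : ∀ i < D.K, D.discReach y i ⊆ interior (D.discReach y (i + 1)) := fun i hi =>
    (Set.subset_add_left _ (Metric.mem_closedBall_self (by positivity))).trans (hgap i hi)
  have hlower : ∀ x, ∀ i < D.K, x ∉ interior (D.discReach y (i + 1)) →
      (D.time P i : EReal) ≤ P.minTime x := by
    intro x i hi hx
    refine hP.le_minTime_of_notMem_reach
      ((Discretization.time_mono ht hi.le).trans_eq Discretization.time_K) fun hxr => hx ?_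
    exact hinterior i hi x fun w hw => hball i hi x hxr w
      ((Metric.mem_closedBall.1 hw).trans (by linarith))
  have hupper : ∀ x, ∀ i < D.K, x ∈ D.discReach y i →
      P.minTime x ≤ (D.time P (i + 1) : ℝ) := by
    intro x i hi hx
    obtain ⟨z, hz, hxz⟩ := hclose i hi.le x hx
    exact P.minTime_le_of_mem_reach (hball i hi z hz x (by linarith))
  have hlast : D.time P (D.K + 1) = D.tf + D.dt P := by
    rw [Discretization.time_succ, Discretization.time_K]
  refine ⟨hgap, fun Γ hΓ => ⟨fun x hx hcase => ?_, fun hfinal x hx => ?_⟩⟩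
  · refine hΓ.abs_minTime_sub_le hD hrun hP.S_convex ht hx (fun i hi hxi => ?_) (hlower x)
    -- For `i = K` the inclusion into the next reachable set is not available; the case hypothesis
    -- replaces it.
    rcases hi.lt_or_eq with hi | rfl
    · exact hupper x i hi hxi
    rw [hlast]
    rcases hcase with ⟨j, hj, hxj⟩ | hT
    · refine (hupper x j hj hxj).trans (EReal.coe_le_coe_iff.2 ?_)
      rw [← hlast]
      exact Discretization.time_mono ht (by omega)
    · exact hT
  · refine hΓ.abs_minTime_sub_le hD hrun hP.S_convex ht hx (fun i hi hxi => ?_) (hlower x)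
    rcases hi.lt_or_eq with hi | rfl
    · exact hupper x i hi hxi
    obtain ⟨z, hz, hxz⟩ := hclose D.K le_rfl x hxi
    rw [Discretization.time_K] at hz
    rw [hlast]
    refine LinearControlSystem.minTime_le_of_mem_reach
      (interior_subset (hfinal ⟨z, hz, x - z, ?_, add_sub_cancel z x⟩))
    rw [mem_closedBall_zero_iff, ← dist_eq_norm]
    linarith
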